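/- A group is torsion-free if its only element of finite order is the identity. For a (commutative) field $K$ and an integer $N\ge 0$, a torsion-free group $G$ is called strongly linear in dimension $N$ over $K$ if there is an injective group homomorphism $\iota\colon G\to GL_N(K)$ such that the closure of $\iota(G)$ for the Zariski topology of $GL_N(K)$ contains $SL_N(K)$. A subgroup $B$ of a group $G$ is called subnormal if there is a finite chain of subgroups $B=B_n\le B_{n-1}\le\dots\le B_1\le B_0=G$ with $B_{i+1}$ normal in $B_i$ for all $0\le i\le n-1$. Let $G$ be a torsion-free group that is strongly linear in dimension $N$ over $K$, and let $B$ be a subnormal subgroup of $G$ that is not contained in the center $Z(G)$. Then: (1) $B$ is strongly linear in dimension $N$ over $K$, and so is every subgroup of finite index of $B$; (2) $Z(B)=Z(G)\cap B$; (3) if $A$ is a normal subgroup of $G$ with $A\not\subset Z(G)$, then $A\cap B\not\subset Z(G)$. -/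

import Mathlib

/-- The set of common zeros in `GL_N(K)` of a set of polynomials in the `N²` matrix entries. -/
def glZeroLocus {N : ℕ} {K : Type*} [Field K] (P : Set (MvPolynomial (Fin N × Fin N) K)) :
    Set (Matrix.GeneralLinearGroup (Fin N) K) :=
  {g | ∀ p ∈ P, MvPolynomial.eval (fun ij : Fin N × Fin N => g.val ij.1 ij.2) p = 0}

/-- The Zariski topology on `GL_N(K)`: the closed sets are the sets of common zeros of polynomials
with coefficients in `K` in the matrix entries. (Since `det` does not vanish on `GL_N(K)`, allowing
also `1 / det` in the polynomials gives the same closed sets.) It is not an instance. -/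
@[reducible]
def zariskiTopology (N : ℕ) (K : Type*) [Field K] :
    TopologicalSpace (Matrix.GeneralLinearGroup (Fin N) K) :=
  TopologicalSpace.ofClosed (Set.range glZeroLocus)
    ⟨{1}, by ext g; simp [glZeroLocus]⟩
    (by
      intro A hA
      refine ⟨{p | ∃ P, glZeroLocus P ∈ A ∧ p ∈ P}, ?_⟩
      ext g
      constructor
      · intro hg S hS
        obtain ⟨P, rfl⟩ := hA hS
        exact fun p hp => hg p ⟨P, hS, hp⟩
      · rintro hg p ⟨P, hP, hp⟩
        exact hg _ hP p hp)
    (by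
      rintro _ ⟨P, rfl⟩ _ ⟨Q, rfl⟩
      refine ⟨{r | ∃ p ∈ P, ∃ q ∈ Q, r = p * q}, ?_⟩
      ext g
      constructor
      · intro hg
        by_contra hcon
        simp only [glZeroLocus, Set.mem_union, Set.mem_ofPred_eq, not_or, not_forall] at hcon
        obtain ⟨⟨p, hp, hp0⟩, ⟨q, hq, hq0⟩⟩ := hcon
        have h := hg (p * q) ⟨p, hp, q, hq, rfl⟩
        rw [map_mul] at h
        exact (mul_ne_zero hp0 hq0) h
      · rintro (hg | hg) _ ⟨p, hp, q, hq, rfl⟩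
        · rw [map_mul, hg p hp, zero_mul]
        · rw [map_mul, hg q hq, mul_zero])

/-- The closure of a subset of `GL_N(K)` for the Zariski topology. -/
def zariskiClosure {N : ℕ} {K : Type*} [Field K]
    (S : Set (Matrix.GeneralLinearGroup (Fin N) K)) :
    Set (Matrix.GeneralLinearGroup (Fin N) K) :=
  @closure _ (zariskiTopology N K) S

/-- A group is torsion-free when its only element of finite order is the identity.
(For non-abelian groups, `IsMulTorsionFree` is the stronger condition that roots are unique.) -/
def IsTorsionFreeGroup (G : Type*) [Group G] : Prop :=
  ∀ g : G, IsOfFinOrder g → g = 1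

/-- `G` is strongly linear in dimension `N` over the field `K`: it is torsion-free and has an
injective morphism to `GL_N(K)` whose image has a Zariski closure containing `SL_N(K)`. -/
def IsStronglyLinear (G : Type*) [Group G] (N : ℕ) (K : Type*) [Field K] : Prop :=
  IsTorsionFreeGroup G ∧
    ∃ ι : G →* Matrix.GeneralLinearGroup (Fin N) K, Function.Injective ι ∧
      {g : Matrix.GeneralLinearGroup (Fin N) K | g.val.det = 1} ⊆ zariskiClosure (Set.range ι)

/-! Call a subgroup dense if its Zariski closure contains `SL_N(K)`. The heart is
`SpecialLinearGroup.range_toGL_le`: over an infinite field, a noncentral subgroup of `GL_N(K)`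
normalized by `SL_N(K)` contains it. Normalization passes to closures, so a noncentral subgroup
normalized by a dense one is dense (`IsSLDense.of_normalized`). Going down a subnormal chain, every
term stays noncentral and hence dense; the field is infinite because a nontrivial torsion-free group
is.

What commutes with a dense subgroup is scalar, which gives the statement on centers. A central
commutator is a scalar of determinant 1, hence of finite order, hence trivial; so if `A ⊓ H` were
central, `H` would commute with the dense `A ⊓ L` of the previous step. For finite index, a central
normal core would make `B` abelian, by transfer to the center. -/

/-- A function on `GL_N(K)` which is a polynomial in the matrix entries divided by a power of the
determinant. -/
def IsRegularOnGL {N : ℕ} {K : Type*} [Field K]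
    (f : Matrix.GeneralLinearGroup (Fin N) K → K) : Prop :=
  ∃ (q : MvPolynomial (Fin N × Fin N) K) (n : ℕ), ∀ g : Matrix.GeneralLinearGroup (Fin N) K,
    MvPolynomial.eval (fun ij : Fin N × Fin N => g.val ij.1 ij.2) q = g.val.det ^ n * f g

/-! ### Regular maps and Zariski closures of subgroups -/

section Regular

variable {N : ℕ} {K : Type*} [Field K]

/-- The generic matrix specializes to every matrix. -/
theorem map_eval_mvPolynomialX (M : Matrix (Fin N) (Fin N) K) :
    (MvPolynomial.eval fun ij : Fin N × Fin N => M ij.1 ij.2).mapMatrix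
      (Matrix.mvPolynomialX (Fin N) (Fin N) K) = M := by
  ext i j
  simp

theorem eval_det_mvPolynomialX (M : Matrix (Fin N) (Fin N) K) :
    MvPolynomial.eval (fun ij : Fin N × Fin N => M ij.1 ij.2)
      (Matrix.mvPolynomialX (Fin N) (Fin N) K).det = M.det := by
  rw [RingHom.map_det, map_eval_mvPolynomialX]

namespace IsRegularOnGL

variable {f f' : Matrix.GeneralLinearGroup (Fin N) K → K}

theorem const (c : K) : IsRegularOnGL (fun _ : Matrix.GeneralLinearGroup (Fin N) K => c) :=
  ⟨MvPolynomial.C c, 0, fun g => by simp⟩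

theorem add (hf : IsRegularOnGL f) (hf' : IsRegularOnGL f') :
    IsRegularOnGL fun g => f g + f' g := by
  obtain ⟨q, n, hq⟩ := hf
  obtain ⟨q', n', hq'⟩ := hf'
  refine ⟨q * (Matrix.mvPolynomialX (Fin N) (Fin N) K).det ^ n' +
    q' * (Matrix.mvPolynomialX (Fin N) (Fin N) K).det ^ n, n + n', fun g => ?_⟩
  rw [map_add, map_mul, map_mul, map_pow, map_pow, hq, hq', eval_det_mvPolynomialX]
  ring

theorem mul (hf : IsRegularOnGL f) (hf' : IsRegularOnGL f') :
    IsRegularOnGL fun g => f g * f' g := by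
  obtain ⟨q, n, hq⟩ := hf
  obtain ⟨q', n', hq'⟩ := hf'
  refine ⟨q * q', n + n', fun g => ?_⟩
  rw [map_mul, hq, hq']
  ring

theorem sub (hf : IsRegularOnGL f) (hf' : IsRegularOnGL f') :
    IsRegularOnGL fun g => f g - f' g := by
  simpa [sub_eq_add_neg] using hf.add ((const (-1)).mul hf')

theorem sum {α : Type*} (s : Finset α) {F : α → Matrix.GeneralLinearGroup (Fin N) K → K}
    (hF : ∀ a ∈ s, IsRegularOnGL (F a)) : IsRegularOnGL fun g => ∑ a ∈ s, F a g := by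
  classical
  induction s using Finset.induction_on with
  | empty => simpa using const (0 : K)
  | insert a s ha ih =>
    simp only [Finset.sum_insert ha]
    exact (hF a (Finset.mem_insert_self a s)).add
      (ih fun b hb => hF b (Finset.mem_insert_of_mem hb))

theorem entry (i j : Fin N) :
    IsRegularOnGL fun g : Matrix.GeneralLinearGroup (Fin N) K => g.val i j :=
  ⟨MvPolynomial.X (i, j), 0, fun g => by simp⟩

/-- Cramer's rule; this is where a power of the determinant in the denominator is needed. -/
theorem inv_entry (i j : Fin N) :
    IsRegularOnGL fun g : Matrix.GeneralLinearGroup (Fin N) K => (g⁻¹).val i j := by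
  refine ⟨(Matrix.mvPolynomialX (Fin N) (Fin N) K).adjugate i j, 1, fun g => ?_⟩
  have h : MvPolynomial.eval (fun ij : Fin N × Fin N => g.val ij.1 ij.2)
      ((Matrix.mvPolynomialX (Fin N) (Fin N) K).adjugate i j) = g.val.adjugate i j := by
    conv_rhs => rw [← map_eval_mvPolynomialX g.val, ← RingHom.map_adjugate]
    rfl
  have hg : g.val.det ≠ 0 := (Matrix.isUnits_det_units g).ne_zero
  beta_reduce
  rw [h, Matrix.coe_units_inv, Matrix.inv_def, Matrix.smul_apply, pow_one, smul_eq_mul,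
    Ring.inverse_eq_inv', mul_inv_cancel_left₀ hg]

theorem mul_entry {φ ψ : Matrix.GeneralLinearGroup (Fin N) K → Matrix.GeneralLinearGroup (Fin N) K}
    (hφ : ∀ i j, IsRegularOnGL fun g => (φ g).val i j)
    (hψ : ∀ i j, IsRegularOnGL fun g => (ψ g).val i j) (i j : Fin N) :
    IsRegularOnGL fun g => (φ g * ψ g).val i j := by
  simp only [Units.val_mul, Matrix.mul_apply]
  exact sum _ fun k _ => (hφ i k).mul (hψ k j)

/-- Polynomials in the entries of a regular map are regular. -/
theorem eval_comp {φ : Matrix.GeneralLinearGroup (Fin N) K → Matrix.GeneralLinearGroup (Fin N) K}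
    (hφ : ∀ i j, IsRegularOnGL fun g => (φ g).val i j) (p : MvPolynomial (Fin N × Fin N) K) :
    IsRegularOnGL fun g =>
      MvPolynomial.eval (fun ij : Fin N × Fin N => (φ g).val ij.1 ij.2) p := by
  induction p using MvPolynomial.induction_on with
  | C a => simpa using const a
  | add p q hp hq => simpa using hp.add hq
  | mul_X p ij hp => simpa using hp.mul (hφ ij.1 ij.2)

theorem isClosed_zeros (hf : IsRegularOnGL f) :
    @IsClosed _ (zariskiTopology N K) {g | f g = 0} := by
  obtain ⟨q, n, hq⟩ := hf
  rw [← @isOpen_compl_iff _ _ (zariskiTopology N K)]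
  change (({g | f g = 0} : Set _)ᶜ)ᶜ ∈ Set.range glZeroLocus
  rw [compl_compl]
  refine ⟨{q}, ?_⟩
  ext g
  have hg : g.val.det ≠ 0 := (Matrix.isUnits_det_units g).ne_zero
  simp [glZeroLocus, hq, hg]

end IsRegularOnGL

theorem isClosed_zariski_iff {S : Set (Matrix.GeneralLinearGroup (Fin N) K)} :
    @IsClosed _ (zariskiTopology N K) S ↔ ∃ P, glZeroLocus P = S := by
  rw [← @isOpen_compl_iff _ _ (zariskiTopology N K)]
  change Sᶜᶜ ∈ Set.range glZeroLocus ↔ _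
  rw [compl_compl, Set.mem_range]

/-- Preimages of closed sets by maps with regular entries are closed. -/
theorem isClosed_preimage_of_isRegularOnGL
    {φ : Matrix.GeneralLinearGroup (Fin N) K → Matrix.GeneralLinearGroup (Fin N) K}
    (hφ : ∀ i j, IsRegularOnGL fun g => (φ g).val i j)
    {S : Set (Matrix.GeneralLinearGroup (Fin N) K)} (hS : @IsClosed _ (zariskiTopology N K) S) :
    @IsClosed _ (zariskiTopology N K) (φ ⁻¹' S) := by
  obtain ⟨P, rfl⟩ := isClosed_zariski_iff.1 hS
  have h : φ ⁻¹' glZeroLocus P = ⋂ p ∈ P,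
      {g | MvPolynomial.eval (fun ij : Fin N × Fin N => (φ g).val ij.1 ij.2) p = 0} := by
    ext g
    simp [glZeroLocus]
  rw [h]
  exact @isClosed_biInter _ _ (zariskiTopology N K) _ _ fun p _ =>
    (IsRegularOnGL.eval_comp hφ p).isClosed_zeros

theorem subset_zariskiClosure (S : Set (Matrix.GeneralLinearGroup (Fin N) K)) :
    S ⊆ zariskiClosure S :=
  @subset_closure _ (zariskiTopology N K) S

theorem isClosed_zariskiClosure (S : Set (Matrix.GeneralLinearGroup (Fin N) K)) :
    @IsClosed _ (zariskiTopology N K) (zariskiClosure S) :=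
  @isClosed_closure _ (zariskiTopology N K) S

theorem zariskiClosure_minimal {S T : Set (Matrix.GeneralLinearGroup (Fin N) K)} (h : S ⊆ T)
    (hT : @IsClosed _ (zariskiTopology N K) T) : zariskiClosure S ⊆ T :=
  @closure_minimal _ (zariskiTopology N K) S T h hT

theorem zariskiClosure_mono {S T : Set (Matrix.GeneralLinearGroup (Fin N) K)} (h : S ⊆ T) :
    zariskiClosure S ⊆ zariskiClosure T :=
  zariskiClosure_minimal (h.trans (subset_zariskiClosure T)) (isClosed_zariskiClosure T)

/-- The Zariski closure of a subgroup of `GL_N(K)`, as a subgroup. -/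
def Subgroup.zariskiClosure (H : Subgroup (Matrix.GeneralLinearGroup (Fin N) K)) :
    Subgroup (Matrix.GeneralLinearGroup (Fin N) K) where
  carrier := _root_.zariskiClosure (H : Set (Matrix.GeneralLinearGroup (Fin N) K))
  one_mem' := subset_zariskiClosure _ H.one_mem
  mul_mem' := by
    intro a b ha hb
    -- One factor varies at a time, since only translations need to be continuous: `b` reaches the
    -- closure first, then `a`.
    have h1 : ∀ x ∈ H, x * b ∈ _root_.zariskiClosure (SetLike.coe H) := fun x hx =>
      zariskiClosure_minimal (S := SetLike.coe H) (T := (x * ·) ⁻¹' _root_.zariskiClosure (SetLike.coe H))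
        (fun y hy => subset_zariskiClosure _ (H.mul_mem hx hy))
        (isClosed_preimage_of_isRegularOnGL
          (IsRegularOnGL.mul_entry (fun _ _ => .const _) .entry) (isClosed_zariskiClosure _)) hb
    exact zariskiClosure_minimal (S := SetLike.coe H) (T := (· * b) ⁻¹' _root_.zariskiClosure (SetLike.coe H)) h1
        (isClosed_preimage_of_isRegularOnGL
          (IsRegularOnGL.mul_entry .entry fun _ _ => .const _) (isClosed_zariskiClosure _)) ha
  inv_mem' := by
    intro a ha
    exact zariskiClosure_minimal (S := SetLike.coe H) (T := (·⁻¹) ⁻¹' _root_.zariskiClosure (SetLike.coe H))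
      (fun y hy => subset_zariskiClosure _ (H.inv_mem hy))
      (isClosed_preimage_of_isRegularOnGL .inv_entry (isClosed_zariskiClosure _)) ha

/-- Elements of the closure of `H` normalize the closure of a subgroup normalized by `H`. -/
theorem conj_mem_zariskiClosure {H D : Subgroup (Matrix.GeneralLinearGroup (Fin N) K)}
    (hHD : ∀ h ∈ H, ∀ d ∈ D, h * d * h⁻¹ ∈ D) {g d : Matrix.GeneralLinearGroup (Fin N) K}
    (hg : g ∈ H.zariskiClosure) (hd : d ∈ D.zariskiClosure) :
    g * d * g⁻¹ ∈ D.zariskiClosure := by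
  have h1 : ∀ h ∈ H, h * d * h⁻¹ ∈ D.zariskiClosure := fun h hh =>
    zariskiClosure_minimal (S := SetLike.coe D) (T := (fun x => h * x * h⁻¹) ⁻¹' zariskiClosure (SetLike.coe D))
      (fun x hx => subset_zariskiClosure _ (hHD h hh x hx))
      (isClosed_preimage_of_isRegularOnGL (IsRegularOnGL.mul_entry
        (IsRegularOnGL.mul_entry (fun _ _ => .const _) .entry) fun _ _ => .const _)
        (isClosed_zariskiClosure _)) hd
  exact zariskiClosure_minimal (S := SetLike.coe H) (T := (fun x => x * d * x⁻¹) ⁻¹' zariskiClosure (SetLike.coe D)) h1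
    (isClosed_preimage_of_isRegularOnGL (IsRegularOnGL.mul_entry
      (IsRegularOnGL.mul_entry .entry fun _ _ => .const _) .inv_entry)
      (isClosed_zariskiClosure _)) hg

/-- An element commuting with a subset commutes with its Zariski closure. -/
theorem commute_of_mem_zariskiClosure {S : Set (Matrix.GeneralLinearGroup (Fin N) K)}
    {g : Matrix.GeneralLinearGroup (Fin N) K} (hg : ∀ s ∈ S, s * g = g * s)
    {x : Matrix.GeneralLinearGroup (Fin N) K} (hx : x ∈ zariskiClosure S) : x * g = g * x := by
  have hc : @IsClosed _ (zariskiTopology N K) (⋂ i, ⋂ j,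
      {x : Matrix.GeneralLinearGroup (Fin N) K | (x * g).val i j - (g * x).val i j = 0}) :=
    @isClosed_iInter _ _ (zariskiTopology N K) _ fun i =>
      @isClosed_iInter _ _ (zariskiTopology N K) _ fun j =>
        ((IsRegularOnGL.mul_entry .entry (fun _ _ => .const _) i j).sub
          (IsRegularOnGL.mul_entry (fun _ _ => .const _) .entry i j)).isClosed_zeros
  have h := zariskiClosure_minimal (fun s hs => by
    simp only [Set.mem_iInter, Set.mem_ofPred_eq, hg s hs, sub_self, implies_true]) hc hx
  simp only [Set.mem_iInter, Set.mem_ofPred_eq, sub_eq_zero] at h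
  exact Units.ext (Matrix.ext h)

end Regular

/-! ### Normal subgroups of the special linear group -/

section SpecialLinear

open Matrix Matrix.SpecialLinearGroup MulAction
open scoped commutatorElement LinearAlgebra.Projectivization

variable {ι F : Type*} [DecidableEq ι] [Fintype ι] [Field F]

/-- Whitehead's factorization `w(a) * w(-1)`, where `w(a)` is the product of the first three
transvections. -/
theorem diag2n_eq_transvection_mul {i j : ι} (hij : i ≠ j) (a : F) (ha : a ≠ 0) :
    diag2n hij a ha = SpecialLinearGroup.transvection hij a *
      SpecialLinearGroup.transvection hij.symm (-a⁻¹) *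
      SpecialLinearGroup.transvection hij a *
      SpecialLinearGroup.transvection hij (-1) *
      SpecialLinearGroup.transvection hij.symm 1 *
      SpecialLinearGroup.transvection hij (-1) := by
  refine Subtype.ext ?_
  have hd : diagonal (fun k ↦ if k = i then a else if k = j then a⁻¹ else 1) =
      (1 : Matrix ι ι F) + single i i (a - 1) + single j j (a⁻¹ - 1) := by
    ext k l
    simp only [diagonal_apply, Matrix.add_apply, one_apply, single_apply]
    grind
  simp only [diag2n_coe, coe_mul, transvection_coe, hd]
  simp only [mul_add, add_mul, one_mul, mul_one, single_mul_single_same,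
    single_mul_single_of_ne _ _ _ _ hij, single_mul_single_of_ne _ _ _ _ hij.symm,
    add_zero]
  ext k l
  simp only [Matrix.add_apply, one_apply, single_apply]
  grind

theorem commutator_diag2n_transvection {i j : ι} (hij : i ≠ j) (a : F) (ha : a ≠ 0) (b : F) :
    ⁅diag2n hij a ha, SpecialLinearGroup.transvection hij b⁆ =
      SpecialLinearGroup.transvection hij (b * (a ^ 2 - 1)) := by
  rw [commutatorElement_def, mul_inv_eq_iff_eq_mul, mul_inv_eq_iff_eq_mul]
  refine Subtype.ext ?_
  simp only [diag2n_coe, coe_mul, transvection_coe]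
  ext k l
  simp only [mul_add, add_mul, one_mul, mul_one, single_mul_single_of_ne _ _ _ _ hij.symm,
    add_zero, Matrix.add_apply, diagonal_mul, mul_diagonal, one_apply, single_apply]
  grind

theorem SpecialLinearGroup.transvection_induction [Nontrivial ι]
    (P : SpecialLinearGroup ι F → Prop)
    (htransvec : ∀ (i j : ι) (h : i ≠ j) c, P (SpecialLinearGroup.transvection h c))
    (hmul : ∀ A B, P A → P B → P (A * B)) (A : SpecialLinearGroup ι F) : P A := by
  refine diagonal_transvection_induction' P _ (fun i j hij c hc ↦ ?_) htransvec hmul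
  rw [diag2n_eq_transvection_mul hij c hc]
  refine hmul _ _ (hmul _ _ (hmul _ _ (hmul _ _ (hmul _ _ ?_ ?_) ?_) ?_) ?_) ?_
  all_goals exact htransvec _ _ _ _

/-- Conjugation by `diag2n` scales the parameter of a transvection by `a ^ 2`; as `a ^ 2 - 1` is
invertible, every transvection is a commutator. -/
theorem SpecialLinearGroup.commutator_eq_top [Nontrivial ι] {a : F} (ha : a ≠ 0)
    (hasq : a ^ 2 ≠ 1) : commutator (SpecialLinearGroup ι F) = ⊤ := by
  refine top_unique fun A _ ↦ SpecialLinearGroup.transvection_induction _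
    (fun i j hij c ↦ ?_) (fun _ _ ↦ mul_mem) A
  rw [← div_mul_cancel₀ c (sub_ne_zero_of_ne hasq), ← commutator_diag2n_transvection hij a ha]
  exact Subgroup.commutator_mem_commutator (Subgroup.mem_top _) (Subgroup.mem_top _)

theorem commutatorElement_mul_left_of_mem_center {G : Type*} [Group G] {z : G}
    (hz : z ∈ Subgroup.center G) (x y : G) : ⁅z * x, y⁆ = ⁅x, y⁆ := by
  have h : z * (x * y * x⁻¹) * z⁻¹ = x * y * x⁻¹ :=
    mul_inv_eq_of_eq_mul (Subgroup.mem_center_iff.1 hz _).symm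
  rw [commutatorElement_def, commutatorElement_def, ← h, _root_.mul_inv_rev]
  simp only [mul_assoc]

/-- The Iwasawa structure of the special linear group acting on projective space. -/
theorem SpecialLinearGroup.nonempty_iwasawaStructure [Nontrivial ι] :
    Nonempty (IwasawaStructure (SpecialLinearGroup ι F) (ℙ F (ι → F))) := by
  refine ⟨⟨fun p ↦ lineStab p.submodule, fun p ↦ ?_, fun g p ↦ ?_, ?_⟩⟩
  · rw [← Projectivization.mk_rep p, Projectivization.submodule_mk]
    exact lineStab_isMulCommutative_of_span p.rep p.rep_nonzero
  · rw [PSL.smul_submodule, lineStab_smul]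
  · refine top_unique fun A _ ↦ SpecialLinearGroup.transvection_induction _
      (fun i j hij c ↦ ?_) (fun _ _ ↦ mul_mem) A
    have h := SL2Gen.transvection_mem_lineStab hij c
    rw [← Projectivization.submodule_mk (K := F) _ (Pi.single_ne_zero_iff.2 one_ne_zero)] at h
    exact Subgroup.mem_iSup_of_mem (S := fun p : ℙ F (ι → F) ↦ lineStab p.submodule) _ h

/-- Noncentral normal subgroups of the special linear group are trivial. -/
theorem SpecialLinearGroup.eq_top_of_normal [Nontrivial ι] {a : F} (ha : a ≠ 0)
    (hasq : a ^ 2 ≠ 1) (M : Subgroup (SpecialLinearGroup ι F)) [M.Normal]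
    (hM : ¬ M ≤ Subgroup.center (SpecialLinearGroup ι F)) : M = ⊤ := by
  obtain ⟨I⟩ := SpecialLinearGroup.nonempty_iwasawaStructure (ι := ι) (F := F)
  rw [eq_top_iff, ← SpecialLinearGroup.commutator_eq_top ha hasq]
  -- Iwasawa's criterion: if `M` fixes every line, it lies in the kernel of the projective action,
  -- which is the center.
  refine I.commutator_le M fun hfix ↦ hM fun m hm ↦ ?_
  rw [← Projectivization.SL_mulAction_ker, MonoidHom.mem_ker]
  ext p : 1
  exact Set.eq_univ_iff_forall.1 hfix p ⟨m, hm⟩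

/-- Noncentral subgroups of `GL_n(F)` normalized by `SL_n(F)` contain it. -/
theorem SpecialLinearGroup.range_toGL_le [Infinite F] (M : Subgroup (GL ι F))
    (hM : ∀ (s : SpecialLinearGroup ι F), ∀ m ∈ M, toGL s * m * (toGL s)⁻¹ ∈ M)
    (hMc : ¬ M ≤ Subgroup.center (GL ι F)) :
    (toGL : SpecialLinearGroup ι F →* GL ι F).range ≤ M := by
  have hι : Nontrivial ι := by
    by_contra hι
    rw [not_nontrivial_iff_subsingleton] at hι
    refine hMc fun m _ ↦ Subgroup.mem_center_iff.2 fun g ↦ Units.ext ?_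
    ext i j
    obtain rfl := Subsingleton.elim i j
    simp [Matrix.mul_apply, Fintype.sum_subsingleton _ i, mul_comm]
  classical
  obtain ⟨a, ha⟩ : ∃ a : F, a ∉ ({0, 1, -1} : Finset F) := Infinite.exists_notMem_finset _
  simp only [Finset.mem_insert, Finset.mem_singleton, not_or] at ha
  obtain ⟨ha, ha1, ha2⟩ := ha
  have hasq : a ^ 2 ≠ 1 := by simp [sq_eq_one_iff, ha1, ha2]
  have hn : (M.comap (toGL : SpecialLinearGroup ι F →* GL ι F)).Normal :=
    ⟨fun m hm s ↦ by simpa using hM s _ hm⟩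
  rw [MonoidHom.range_eq_map, Subgroup.map_le_iff_le_comap]
  refine (SpecialLinearGroup.eq_top_of_normal ha hasq _ fun hcen ↦ hMc fun m hm ↦ ?_).ge
  let ψ : SpecialLinearGroup ι F →* GL ι F := (MulAut.conj m).toMonoidHom.comp toGL
  -- This is the commutator of `m` and `s`: it lies in `M` and has determinant 1, so it is central
  -- by `hcen`.
  have hψ : ∀ s, ψ s * (toGL s)⁻¹ ∈ Subgroup.center (GL ι F) := fun s ↦ by
    have hdet : (ψ s * (toGL s)⁻¹).val.det = 1 := by
      refine congrArg Units.val
        (show GeneralLinearGroup.det (ψ s * (toGL s)⁻¹) = 1 from ?_)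
      have hs : ψ s = m * toGL s * m⁻¹ := rfl
      simp only [hs, map_mul, map_inv]
      rw [mul_inv_cancel_comm, mul_inv_cancel]
    let σ : SpecialLinearGroup ι F := ⟨_, hdet⟩
    have h1 : toGL σ = ψ s * (toGL s)⁻¹ := Units.ext rfl
    rw [← h1, SpecialLinearGroup.toGL_mem_center_iff]
    refine hcen ?_
    rw [Subgroup.mem_comap, h1]
    have := M.mul_mem hm (hM s _ (M.inv_mem hm))
    simpa [ψ, mul_assoc] using this
  -- Central factors drop out of commutators, so conjugation by `m` fixes them; as the special
  -- linear group is perfect, `m` centralizes it and is scalar.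
  have hagree : commutator (SpecialLinearGroup ι F) ≤ ψ.eqLocus toGL := by
    refine Subgroup.commutator_le.2 fun s _ t _ ↦ ?_
    change ψ ⁅s, t⁆ = toGL ⁅s, t⁆
    rw [map_commutatorElement, map_commutatorElement, ← inv_mul_cancel_right (ψ s) (toGL s),
      ← inv_mul_cancel_right (ψ t) (toGL t), commutatorElement_mul_left_of_mem_center (hψ s),
      ← commutatorElement_inv, commutatorElement_mul_left_of_mem_center (hψ t),
      commutatorElement_inv]
  rw [SpecialLinearGroup.commutator_eq_top ha hasq] at hagree
  rw [GeneralLinearGroup.mem_center_iff_val_mem_range_scalar]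
  refine mem_range_scalar_of_commute_transvectionStruct fun t ↦ ?_
  have h : m * toGL t.toSpecialLinearGroup * m⁻¹ = toGL t.toSpecialLinearGroup :=
    hagree (Subgroup.mem_top t.toSpecialLinearGroup)
  exact (congrArg Units.val (mul_inv_eq_iff_eq_mul.1 h)).symm

end SpecialLinear

/-! ### Dense subgroups of torsion-free linear groups -/

section Density

open Matrix Matrix.SpecialLinearGroup
open scoped commutatorElement

variable {N : ℕ} {K : Type*} [Field K]

/-- A subset of `GL_N(K)` whose Zariski closure contains `SL_N(K)`. -/
def IsSLDense (S : Set (GL (Fin N) K)) : Prop :=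
  {g : GL (Fin N) K | g.val.det = 1} ⊆ zariskiClosure S

theorem IsSLDense.mono {S T : Set (GL (Fin N) K)} (hS : IsSLDense S) (h : S ⊆ T) : IsSLDense T :=
  Set.Subset.trans hS (zariskiClosure_mono h)

theorem IsSLDense.mem_center {S : Set (GL (Fin N) K)} (hS : IsSLDense S) {g : GL (Fin N) K}
    (hg : ∀ s ∈ S, s * g = g * s) : g ∈ Subgroup.center (GL (Fin N) K) := by
  rw [GeneralLinearGroup.mem_center_iff_val_mem_range_scalar]
  refine mem_range_scalar_of_commute_transvectionStruct fun t ↦ ?_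
  have ht : toGL t.toSpecialLinearGroup ∈ zariskiClosure S := hS t.toSpecialLinearGroup.2
  exact congrArg Units.val (commute_of_mem_zariskiClosure hg ht)

/-- A noncentral subgroup normalized by a dense subgroup is dense. -/
theorem IsSLDense.of_normalized [Infinite K] {H D : Subgroup (GL (Fin N) K)}
    (hH : IsSLDense (H : Set (GL (Fin N) K))) (hHD : ∀ h ∈ H, ∀ d ∈ D, h * d * h⁻¹ ∈ D)
    (hD : ¬ D ≤ Subgroup.center (GL (Fin N) K)) : IsSLDense (D : Set (GL (Fin N) K)) := by
  intro g hg
  refine SpecialLinearGroup.range_toGL_le D.zariskiClosure (fun s m hm ↦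
    conj_mem_zariskiClosure hHD (hH s.2) hm)
    (fun h ↦ hD (Set.Subset.trans (subset_zariskiClosure _) h)) ⟨⟨g.val, hg⟩, Units.ext rfl⟩

variable {G : Type*} [Group G]

theorem map_mem_center_iff {ι : G →* GL (Fin N) K} (hι : Function.Injective ι)
    (hd : IsSLDense (Set.range ι)) {g : G} :
    ι g ∈ Subgroup.center (GL (Fin N) K) ↔ g ∈ Subgroup.center G := by
  refine ⟨fun h ↦ Subgroup.mem_center_iff.2 fun x ↦ hι ?_, fun h ↦ hd.mem_center ?_⟩
  · rw [map_mul, map_mul, Subgroup.mem_center_iff.1 h]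
  · rintro _ ⟨x, rfl⟩
    rw [← map_mul, ← map_mul, Subgroup.mem_center_iff.1 h]

theorem map_le_center_iff {ι : G →* GL (Fin N) K} (hι : Function.Injective ι)
    (hd : IsSLDense (Set.range ι)) {H : Subgroup G} :
    H.map ι ≤ Subgroup.center (GL (Fin N) K) ↔ H ≤ Subgroup.center G := by
  rw [Subgroup.map_le_iff_le_comap]
  exact forall₂_congr fun g _ ↦ map_mem_center_iff hι hd

/-- A noncentral subgroup normalized by a dense subgroup is dense. -/
theorem isSLDense_map_of_normalized [Infinite K] {ι : G →* GL (Fin N) K}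
    (hι : Function.Injective ι) (hd : IsSLDense (Set.range ι)) {H D : Subgroup G}
    (hH : IsSLDense (H.map ι : Set (GL (Fin N) K))) (hHD : ∀ h ∈ H, ∀ d ∈ D, h * d * h⁻¹ ∈ D)
    (hD : ¬ D ≤ Subgroup.center G) : IsSLDense (D.map ι : Set (GL (Fin N) K)) := by
  refine hH.of_normalized ?_ (by rwa [map_le_center_iff hι hd])
  rintro _ ⟨h, hh, rfl⟩ _ ⟨d, hd', rfl⟩
  exact ⟨h * d * h⁻¹, hHD h hh d hd', by simp⟩

theorem mem_center_of_commute_isSLDense {ι : G →* GL (Fin N) K} (hι : Function.Injective ι)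
    (hd : IsSLDense (Set.range ι)) {H : Subgroup G} (hH : IsSLDense (H.map ι : Set (GL (Fin N) K)))
    {g : G} (hg : ∀ h ∈ H, h * g = g * h) : g ∈ Subgroup.center G := by
  rw [← map_mem_center_iff hι hd]
  refine hH.mem_center ?_
  rintro _ ⟨h, hh, rfl⟩
  rw [← map_mul, ← map_mul, hg h hh]

theorem conj_mem_of_normal_subgroupOf {H L : Subgroup G} (hHL : H ≤ L) (hn : (H.subgroupOf L).Normal)
    {l h : G} (hl : l ∈ L) (hh : h ∈ H) : l * h * l⁻¹ ∈ H := by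
  simpa [Subgroup.mem_subgroupOf] using
    hn.conj_mem ⟨h, hHL hh⟩ (Subgroup.mem_subgroupOf.2 hh) ⟨l, hl⟩

/-- Noncentral subnormal subgroups are dense. -/
theorem Subgroup.IsSubnormal.isSLDense_map [Infinite K] {ι : G →* GL (Fin N) K}
    (hι : Function.Injective ι) (hd : IsSLDense (Set.range ι)) {B : Subgroup G}
    (hB : B.IsSubnormal) (hBZ : ¬ B ≤ Subgroup.center G) :
    IsSLDense (B.map ι : Set (GL (Fin N) K)) := by
  induction hB with
  | top => simpa [← MonoidHom.range_eq_map] using hd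
  | step H L hHL hL hn ih =>
    exact isSLDense_map_of_normalized hι hd (ih fun h ↦ hBZ (hHL.trans h))
      (fun l hl h hh ↦ conj_mem_of_normal_subgroupOf hHL hn hl hh) hBZ

/-- Central commutators in a torsion-free group with dense image are trivial. -/
theorem commutatorElement_eq_one_of_mem_center (hG : IsTorsionFreeGroup G)
    {ι : G →* GL (Fin N) K} (hι : Function.Injective ι) (hd : IsSLDense (Set.range ι)) {a b : G}
    (hab : ⁅a, b⁆ ∈ Subgroup.center G) : ⁅a, b⁆ = 1 := by
  rcases Nat.eq_zero_or_pos N with rfl | hN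
  · exact hι (Subsingleton.elim _ _)
  rw [← map_mem_center_iff hι hd, GeneralLinearGroup.mem_center_iff_val_mem_range_scalar] at hab
  obtain ⟨c, hc⟩ := hab
  have hdet : (ι ⁅a, b⁆).val.det = 1 := by
    refine congrArg Units.val (show GeneralLinearGroup.det (ι ⁅a, b⁆) = 1 from ?_)
    rw [map_commutatorElement, map_commutatorElement, commutatorElement_eq_one_iff_mul_comm,
      mul_comm]
  refine hG _ (isOfFinOrder_iff_pow_eq_one.2 ⟨N, hN, hι (Units.ext ?_)⟩)
  have hcN : c ^ N = 1 := by
    rw [← hc] at hdet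
    simpa using hdet
  rw [map_pow, map_one, Units.val_pow_eq_pow_val, ← hc, ← map_pow, hcN, map_one, Units.val_one]

/-- Noncentral normal subgroups meet noncentral subnormal subgroups noncentrally. -/
theorem Subgroup.IsSubnormal.not_inf_le_center [Infinite K] (hG : IsTorsionFreeGroup G)
    {ι : G →* GL (Fin N) K} (hι : Function.Injective ι) (hd : IsSLDense (Set.range ι))
    {A B : Subgroup G} (hA : A.Normal) (hAZ : ¬ A ≤ Subgroup.center G)
    (hB : B.IsSubnormal) (hBZ : ¬ B ≤ Subgroup.center G) : ¬ A ⊓ B ≤ Subgroup.center G := by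
  induction hB with
  | top => simpa using hAZ
  | step H L hHL hL hn ih =>
    intro hle
    have hLZ : ¬ L ≤ Subgroup.center G := fun h ↦ hBZ (hHL.trans h)
    have hdense : IsSLDense ((A ⊓ L).map ι : Set (GL (Fin N) K)) :=
      isSLDense_map_of_normalized hι hd (hL.isSLDense_map hι hd hLZ)
        (fun l hl a ha ↦ ⟨hA.conj_mem a ha.1 l, L.mul_mem (L.mul_mem hl ha.2) (L.inv_mem hl)⟩)
        (ih hLZ)
    -- For `a` in `A ⊓ L`, the commutator of `a` and `h` lies in `A ⊓ H`, by normality of `A` in `G`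
    -- and of `H` in `L`.
    refine hBZ fun h hh ↦ mem_center_of_commute_isSLDense hι hd hdense fun a ha ↦ ?_
    rw [← commutatorElement_eq_one_iff_mul_comm]
    refine commutatorElement_eq_one_of_mem_center hG hι hd (hle ⟨?_, ?_⟩)
    · rw [commutatorElement_def, mul_assoc, mul_assoc, ← mul_assoc h]
      exact A.mul_mem ha.1 (hA.conj_mem _ (A.inv_mem ha.1) h)
    · exact H.mul_mem (conj_mem_of_normal_subgroupOf hHL hn ha.2 hh) (H.inv_mem hh)

/-- A torsion-free group whose center has finite index is commutative. -/
theorem IsTorsionFreeGroup.mul_comm_of_finiteIndex_center (hG : IsTorsionFreeGroup G)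
    [hfin : (Subgroup.center G).FiniteIndex] (a b : G) : a * b = b * a := by
  -- The transfer to the center is `g ↦ g ^ index`, so torsion-freeness embeds the group in an
  -- abelian one.
  have hinj : Function.Injective (MonoidHom.transferCenterPow G) := by
    refine (injective_iff_map_eq_one _).2 fun g hg ↦ hG g (isOfFinOrder_iff_pow_eq_one.2
      ⟨(Subgroup.center G).index, Nat.pos_of_ne_zero hfin.index_ne_zero, ?_⟩)
    rw [← MonoidHom.transferCenterPow_apply, hg, Subgroup.coe_one]
  exact hinj (by rw [map_mul, map_mul]; exact IsMulCommutative.is_comm.comm _ _)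

theorem IsTorsionFreeGroup.of_injective {G' : Type*} [Group G'] (hG : IsTorsionFreeGroup G)
    {f : G' →* G} (hf : Function.Injective f) : IsTorsionFreeGroup G' := fun g hg ↦
  hf (by rw [hG _ (f.isOfFinOrder hg), map_one])

theorem IsTorsionFreeGroup.infinite_of_injective (hG : IsTorsionFreeGroup G)
    {ι : G →* GL (Fin N) K} (hι : Function.Injective ι) {g : G} (hg : g ≠ 1) : Infinite K := by
  by_contra hK
  rw [not_infinite_iff_finite] at hK
  have : Finite G := Finite.of_injective ι hι
  exact hg (hG g (isOfFinOrder_of_finite g))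

/-- Finite-index subgroups of noncentral subnormal subgroups are dense. -/
theorem Subgroup.IsSubnormal.isSLDense_map_of_finiteIndex [Infinite K] (hG : IsTorsionFreeGroup G)
    {ι : G →* GL (Fin N) K} (hι : Function.Injective ι) (hd : IsSLDense (Set.range ι))
    {B : Subgroup G} (hB : B.IsSubnormal) (hBZ : ¬ B ≤ Subgroup.center G) (C : Subgroup B)
    [C.FiniteIndex] : IsSLDense ((C.map B.subtype).map ι : Set (GL (Fin N) K)) := by
  have hBd := hB.isSLDense_map hι hd hBZ
  -- The normal core, unlike `C`, is normalized by `B`, so density needs only that it be noncentral.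
  have hnd : ¬ C.normalCore.map B.subtype ≤ Subgroup.center G := fun hle ↦ by
    have hcore : C.normalCore ≤ Subgroup.center B := fun c hc ↦ Subgroup.mem_center_iff.2 fun b ↦
      Subtype.ext (Subgroup.mem_center_iff.1 (hle ⟨c, hc, rfl⟩) b)
    have := Subgroup.finiteIndex_of_le hcore
    refine hBZ fun b hb ↦ mem_center_of_commute_isSLDense hι hd hBd fun h hh ↦ ?_
    exact congrArg Subtype.val ((hG.of_injective B.subtype_injective).mul_comm_of_finiteIndex_center
      (⟨h, hh⟩ : B) ⟨b, hb⟩)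
  refine (isSLDense_map_of_normalized hι hd hBd ?_ hnd).mono ?_
  · rintro b hb _ ⟨c, hc, rfl⟩
    exact ⟨_, (inferInstance : C.normalCore.Normal).conj_mem c hc ⟨b, hb⟩, rfl⟩
  · exact Subgroup.map_mono (Subgroup.map_mono C.normalCore_le)

end Density

theorem mainTheorem5 {G : Type*} [Group G] (N : ℕ) (K : Type*) [Field K]
    (hG : IsStronglyLinear G N K) (B : Subgroup G) (hB : B.IsSubnormal)
    (hBZ : ¬ B ≤ Subgroup.center G) :
    (IsStronglyLinear B N K ∧ ∀ C : Subgroup B, C.FiniteIndex → IsStronglyLinear C N K) ∧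
    (Subgroup.center B).map B.subtype = Subgroup.center G ⊓ B ∧
    (∀ A : Subgroup G, A.Normal → ¬ A ≤ Subgroup.center G →
      ¬ A ⊓ B ≤ Subgroup.center G) := by
  obtain ⟨htf, ι, hι, hd⟩ := hG
  obtain ⟨b, -, hbZ⟩ := SetLike.not_le_iff_exists.1 hBZ
  have : Infinite K := htf.infinite_of_injective hι (g := b)
    fun h ↦ hbZ (h ▸ (Subgroup.center G).one_mem)
  have hBd := hB.isSLDense_map hι hd hBZ
  refine ⟨⟨⟨htf.of_injective B.subtype_injective, ι.comp B.subtype,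
    hι.comp B.subtype_injective, ?_⟩, fun C hC ↦ ⟨(htf.of_injective B.subtype_injective).of_injective
      C.subtype_injective, (ι.comp B.subtype).comp C.subtype,
      (hι.comp B.subtype_injective).comp C.subtype_injective, ?_⟩⟩, ?_, fun A hA hAZ ↦
      hB.not_inf_le_center htf hι hd hA hAZ hBZ⟩
  · refine IsSLDense.mono hBd ?_
    rintro _ ⟨b, hb, rfl⟩
    exact ⟨⟨b, hb⟩, rfl⟩
  · refine IsSLDense.mono (hB.isSLDense_map_of_finiteIndex htf hι hd hBZ C) ?_
    rintro _ ⟨_, ⟨c, hc, rfl⟩, rfl⟩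
    exact ⟨⟨c, hc⟩, rfl⟩
  · ext g
    constructor
    · rintro ⟨c, hc, rfl⟩
      exact ⟨mem_center_of_commute_isSLDense hι hd hBd fun h hh ↦
        congrArg Subtype.val (Subgroup.mem_center_iff.1 hc ⟨h, hh⟩), c.2⟩
    · rintro ⟨hg, hgB⟩
      exact ⟨⟨g, hgB⟩, Subgroup.mem_center_iff.2 fun b ↦
        Subtype.ext (Subgroup.mem_center_iff.1 hg b), rfl⟩
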